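/- Let $k$ be a field, let $k[X,Y]$ be the polynomial ring in two variables, and let $R$ be one of the subrings $R_1 = k[X^4, XY^3, Y^4]$ and $R_2 = k[X^5, XY^4, Y^5]$ of $k[X,Y]$. Let $\overline{R}$ be the integral closure of $R$ in its (total) ring of fractions $\mathrm{Q}(R)$. The strict closure of $R$ is $R^* = \{\alpha \in \overline{R} \mid \alpha \otimes 1 = 1 \otimes \alpha \text{ in } \overline{R} \otimes_R \overline{R}\}$. The weakly Arf closure of $R$ is $R^a = \bigcup_{n \ge 0} A_n$, where $A_0 = R$ and, for $n \geq 0$, $A_{n+1}$ is the subring of $\mathrm{Q}(R)$ generated over $A_n$ by all fractions $\frac{yz}{x}$ with $x, y, z \in A_n$, $x$ a non-zerodivisor, and $\frac{y}{x}, \frac{z}{x}$ integral over $A_n$. Then $R \subsetneq R^a = R^*$. Moreover, $R^a$ is a Noetherian ring that does not satisfy Serre's condition $(S_2)$; that is, there is a prime ideal $P$ of $R^a$ with $\operatorname{depth} (R^a)_P < \min\{2, \dim (R^a)_P\}$. -/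

import Mathlib

open scoped TensorProduct

noncomputable section

/-- The strict closure of `R` in an `R`-algebra `S`: the elements `α` of `S` such that
`α ⊗ 1 = 1 ⊗ α` in `S ⊗[R] S`. -/
def strictClosureIn (R S : Type*) [CommRing R] [CommRing S] [Algebra R S] : Subalgebra R S :=
  AlgHom.equalizer (Algebra.TensorProduct.includeLeft : S →ₐ[R] S ⊗[R] S)
    (Algebra.TensorProduct.includeRight : S →ₐ[R] S ⊗[R] S)

theorem mem_strictClosureIn {R S : Type*} [CommRing R] [CommRing S] [Algebra R S] {α : S} :
    α ∈ strictClosureIn R S ↔ α ⊗ₜ[R] (1 : S) = (1 : S) ⊗ₜ[R] α :=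
  Iff.rfl

/-- The strict closure `R^*` of `R` in the integral closure of `R` in its total ring of
fractions `FractionRing R`, regarded as an intermediate ring of `FractionRing R` over `R`. -/
def strictClosure (R : Type*) [CommRing R] : Subalgebra R (FractionRing R) :=
  (strictClosureIn R (integralClosure R (FractionRing R))).map
    (integralClosure R (FractionRing R)).val

/-- For an intermediate ring `A` of `Q` over `R`, where `Q` is the total ring of fractions of `A`,
the ring generated over `A` by all fractions `yz/x`, where `x` is a non-zerodivisor of `A` and
`y`, `z` are elements of `A` such that `y/x` and `z/x` are integral over `A`.
(Such an `x` is a unit of `Q`, so `u = y/x`, `v = z/x` and `q = yz/x` below.) -/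
def weaklyArfStep {R Q : Type*} [CommRing R] [CommRing Q] [Algebra R Q] (A : Subalgebra R Q) :
    Subalgebra R Q :=
  Algebra.adjoin R ((A : Set Q) ∪ {q : Q | ∃ x y z : A, x ∈ nonZeroDivisors A ∧
    (∃ u : Q, IsIntegral A u ∧ u * (x : Q) = y) ∧
    (∃ v : Q, IsIntegral A v ∧ v * (x : Q) = z) ∧
    q * (x : Q) = y * z})

/-- The tower `R = R₀ ⊆ R₁ ⊆ R₂ ⊆ ⋯` in the total ring of fractions of `R`. -/
def weaklyArfTower (R : Type*) [CommRing R] : ℕ → Subalgebra R (FractionRing R)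
  | 0 => ⊥
  | n + 1 => weaklyArfStep (weaklyArfTower R n)

/-- The weakly Arf closure `R^a` of `R`, the union of the tower `weaklyArfTower R`. -/
def weaklyArfClosure (R : Type*) [CommRing R] : Subalgebra R (FractionRing R) :=
  ⨆ n, weaklyArfTower R n

theorem weaklyArfTower_mono (R : Type*) [CommRing R] : Monotone (weaklyArfTower R) :=
  monotone_nat_of_le_succ fun _ _ hx => Algebra.subset_adjoin (Or.inl hx)

/-- The supremum defining `weaklyArfClosure` is the set-theoretic union. -/
theorem mem_weaklyArfClosure {R : Type*} [CommRing R] {q : FractionRing R} :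
    q ∈ weaklyArfClosure R ↔ ∃ n, q ∈ weaklyArfTower R n := by
  rw [weaklyArfClosure, ← SetLike.mem_coe,
    Subalgebra.coe_iSup_of_directed (weaklyArfTower_mono R).directed_le]
  simp

/-- The depth of a (Noetherian) local ring: the supremum of the lengths of the regular sequences
contained in the maximal ideal. -/
def localDepth (A : Type*) [CommRing A] [IsLocalRing A] : ℕ∞ :=
  ⨆ (rs : List A) (_ : (∀ r ∈ rs, r ∈ IsLocalRing.maximalIdeal A) ∧
    RingTheory.Sequence.IsRegular A rs), (rs.length : ℕ∞)

/-- Serre's condition `(S_n)` for a (Noetherian) ring: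
`depth A_P ≥ min {n, dim A_P}` for all prime ideals `P`. -/
def SerreCondition (n : ℕ) (A : Type*) [CommRing A] : Prop :=
  ∀ (P : Ideal A) [P.IsPrime],
    min (n : WithBot ℕ∞) (ringKrullDim (Localization.AtPrime P)) ≤
      (localDepth (Localization.AtPrime P) : WithBot ℕ∞)

end

/-!
`k[X, Y]` is integral over `R` and normal, so all closures can be compared inside it, and tensor
products of monomial algebras are multigraded. If a monomial `w` lies in the strict closure, then
within the box `[0, w]` it is connected to `0` by steps along the exponents of the generators: a
set `D` of exponents that is stable under such steps, contains `w` and avoids `0` yields a balanced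
bilinear form separating `w ⊗ 1` from `1 ⊗ w`. What remains is a monomial algebra `k[S]`, and Arf
fractions already produce generators of it. Finally `X ^ (n - 1) * Y ^ (n + 1)` is not in `k[S]`,
but all of its multiples by nonconstant monomials of `k[S]` are; hence the augmentation ideal has
depth one, although its height is at least two.
-/

section Depth

variable {A : Type*} [CommRing A]

theorem isSMulRegular_quotSMulTop_self_iff {r s : A} :
    IsSMulRegular (QuotSMulTop r A) s ↔ ∀ x, r ∣ s * x → r ∣ x := by
  simp only [QuotSMulTop, isSMulRegular_quotient_iff_mem_of_smul_mem,
    Submodule.mem_smul_pointwise_iff_exists, Submodule.mem_top, true_and, smul_eq_mul,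
    dvd_def, eq_comm]

theorem not_isRegular_cons_cons_of_dvd_mul {a b r₁ r₂ : A} {rs : List A}
    (ha : a ∈ nonZeroDivisors A) (hb : ¬ a ∣ b) (h₁ : a ∣ r₁ * b) (h₂ : a ∣ r₂ * b) :
    ¬ RingTheory.Sequence.IsRegular A (r₁ :: r₂ :: rs) := by
  rw [RingTheory.Sequence.isRegular_cons_iff, RingTheory.Sequence.isRegular_cons_iff,
    isSMulRegular_quotSMulTop_self_iff]
  rintro ⟨hr₁, hr₂, -⟩
  obtain ⟨e₁, he₁⟩ := h₁
  obtain ⟨e₂, he₂⟩ := h₂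
  have hswap : r₂ * e₁ = r₁ * e₂ :=
    (mul_cancel_left_mem_nonZeroDivisors ha).1 (by linear_combination r₁ * he₂ - r₂ * he₁)
  obtain ⟨d, rfl⟩ := hr₂ e₁ ⟨e₂, hswap⟩
  exact hb ⟨d, hr₁ (by simpa [mul_left_comm] using he₁)⟩

theorem localDepth_le_one_of_forall_dvd_mul [IsLocalRing A] {a b : A}
    (ha : a ∈ nonZeroDivisors A) (hb : ¬ a ∣ b)
    (h : ∀ r ∈ IsLocalRing.maximalIdeal A, a ∣ r * b) : localDepth A ≤ 1 := by
  refine iSup₂_le ?_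
  rintro rs ⟨hrs, hreg⟩
  match rs with
  | [] => simp
  | [_] => simp
  | r₁ :: r₂ :: _ =>
    exact absurd hreg (not_isRegular_cons_cons_of_dvd_mul ha hb (h r₁ (hrs r₁ (by simp)))
      (h r₂ (hrs r₂ (by simp))))

theorem localDepth_atPrime_le_one [IsDomain A] (M : Ideal A) [M.IsPrime] {a b : A}
    (ha : a ≠ 0) (h : ∀ s, s ∈ M ↔ a ∣ s * b) :
    localDepth (Localization.AtPrime M) ≤ 1 := by
  let B := Localization.AtPrime M
  have hinj : Function.Injective (algebraMap A B) := FaithfulSMul.algebraMap_injective A B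
  refine localDepth_le_one_of_forall_dvd_mul (a := algebraMap A B a) (b := algebraMap A B b)
    (mem_nonZeroDivisors_of_ne_zero ((map_ne_zero_iff _ hinj).2 ha)) ?_ fun r hr => ?_
  · rintro ⟨c, hc⟩
    obtain ⟨⟨t, s⟩, hts⟩ := IsLocalization.surj M.primeCompl c
    refine s.2 ((h s).2 ⟨t, hinj ?_⟩)
    rw [map_mul, map_mul, ← hts, hc]
    ring
  · obtain ⟨⟨t, s⟩, hts⟩ := IsLocalization.surj M.primeCompl r
    have ht : t ∈ M := by
      rw [← IsLocalization.AtPrime.to_map_mem_maximal_iff B M t, ← hts]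
      exact Ideal.mul_mem_right _ _ hr
    have hs : IsUnit (algebraMap A B s) := IsLocalization.map_units B s
    have hdvd : algebraMap A B a ∣ algebraMap A B s * (r * algebraMap A B b) := by
      rw [← mul_assoc, mul_comm _ r, hts, ← map_mul]
      exact map_dvd _ ((h t).1 ht)
    exact hs.dvd_mul_left.1 hdvd

theorem not_serreCondition_two_of_mem_iff_dvd_mul [IsDomain A] {p M : Ideal A} [p.IsPrime]
    [M.IsPrime] (hp : ⊥ < p) (hpM : p < M) {a b : A} (ha : a ≠ 0)
    (h : ∀ s, s ∈ M ↔ a ∣ s * b) : ¬ SerreCondition 2 A := by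
  intro hS
  have hheight : (2 : ℕ∞) ≤ M.height := by
    calc (2 : ℕ∞) = 0 + 1 + 1 := by norm_num
      _ ≤ (⊥ : Ideal A).height + 1 + 1 := by gcongr; exact zero_le
      _ ≤ p.height + 1 := by gcongr; exact Ideal.height_add_one_le_of_lt_of_isPrime hp
      _ ≤ M.height := Ideal.height_add_one_le_of_lt_of_isPrime hpM
  have hdepth : ((2 : ℕ∞) : WithBot ℕ∞) ≤ localDepth (Localization.AtPrime M) := by
    rw [← min_eq_left (WithBot.coe_le_coe.2 hheight),
      ← IsLocalization.AtPrime.ringKrullDim_eq_height M (Localization.AtPrime M)]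
    exact hS M
  have : (2 : ℕ∞) ≤ 1 :=
    (WithBot.coe_le_coe.1 hdepth).trans (localDepth_atPrime_le_one M ha h)
  exact absurd this (by norm_num)

end Depth

section RingEquiv

variable {A B : Type*} [CommRing A] [CommRing B]

theorem localDepth_le_of_ringEquiv [IsLocalRing A] [IsLocalRing B] (e : A ≃+* B) :
    localDepth A ≤ localDepth B := by
  refine iSup₂_le ?_
  rintro rs ⟨hrs, hreg⟩
  have hmem : ∀ r ∈ rs.map e, r ∈ IsLocalRing.maximalIdeal B := by
    simpa only [List.forall_mem_map, IsLocalRing.mem_maximalIdeal, mem_nonunits_iff,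
      MulEquiv.isUnit_map] using hrs
  have hreg' : RingTheory.Sequence.IsRegular B (rs.map e) :=
    (e.toAddEquiv.isRegular_congr (List.forall₂_map_right_iff.2
      (List.forall₂_same.2 fun r _ x => map_mul e r x))).1 hreg
  calc (rs.length : ℕ∞) = ((rs.map e).length : ℕ∞) := by rw [List.length_map]
    _ ≤ localDepth B := le_iSup₂_of_le (rs.map e) ⟨hmem, hreg'⟩ le_rfl

theorem SerreCondition.of_ringEquiv {n : ℕ} (e : A ≃+* B) (h : SerreCondition n A) :
    SerreCondition n B := by
  intro P _
  let e' : Localization.AtPrime (P.comap e) ≃+* Localization.AtPrime P :=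
    Localization.localRingEquiv _ P e rfl
  rw [← ringKrullDim_eq_of_ringEquiv e']
  exact (h (P.comap e)).trans (WithBot.coe_le_coe.2 (localDepth_le_of_ringEquiv e'))

end RingEquiv

section Closures

theorem tmul_comm_of_mem_strictClosureIn {R S : Type*} [CommRing R] [CommRing S] [Algebra R S]
    {a : S} (ha : a ∈ strictClosureIn R S) (s t : S) : (s * a) ⊗ₜ[R] t = s ⊗ₜ[R] (a * t) := by
  have := congrArg (fun z => (s ⊗ₜ[R] t) * z) (mem_strictClosureIn.1 ha)
  simpa [Algebra.TensorProduct.tmul_mul_tmul, mul_comm] using this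

theorem mul_mul_mem_strictClosureIn {R S : Type*} [CommRing R] [CommRing S] [Algebra R S]
    {x u v : S} (hx : x ∈ strictClosureIn R S) (hu : u * x ∈ strictClosureIn R S)
    (hv : v * x ∈ strictClosureIn R S) : u * v * x ∈ strictClosureIn R S := by
  rw [mem_strictClosureIn]
  calc (u * v * x) ⊗ₜ[R] (1 : S) = (v * (u * x)) ⊗ₜ[R] 1 := by ring_nf
    _ = v ⊗ₜ[R] (x * u) := by rw [tmul_comm_of_mem_strictClosureIn hu]; ring_nf
    _ = (1 * (v * x)) ⊗ₜ[R] u := by rw [← tmul_comm_of_mem_strictClosureIn hx, one_mul]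
    _ = 1 ⊗ₜ[R] (u * v * x) := by rw [tmul_comm_of_mem_strictClosureIn hv]; ring_nf

variable {R : Type*} [CommRing R]

theorem coe_mem_strictClosure_iff {s : integralClosure R (FractionRing R)} :
    (s : FractionRing R) ∈ strictClosure R ↔
      s ∈ strictClosureIn R (integralClosure R (FractionRing R)) := by
  simp [strictClosure]

theorem strictClosure_le_integralClosure :
    strictClosure R ≤ integralClosure R (FractionRing R) := by
  rintro _ ⟨s, -, rfl⟩
  exact s.2

theorem mul_mul_mem_strictClosure {x u v : FractionRing R} (hu : IsIntegral R u)
    (hv : IsIntegral R v) (hx : x ∈ strictClosure R) (hux : u * x ∈ strictClosure R)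
    (hvx : v * x ∈ strictClosure R) : u * v * x ∈ strictClosure R := by
  lift x to integralClosure R (FractionRing R) using strictClosure_le_integralClosure hx
  lift u to integralClosure R (FractionRing R) using hu
  lift v to integralClosure R (FractionRing R) using hv
  norm_cast at *
  rw [coe_mem_strictClosure_iff] at *
  exact mul_mul_mem_strictClosureIn hx hux hvx

theorem coe_mem_nonZeroDivisors_fractionRing {A : Subalgebra R (FractionRing R)} {x : A}
    (hx : x ∈ nonZeroDivisors A) : (x : FractionRing R) ∈ nonZeroDivisors (FractionRing R) := by
  refine mem_nonZeroDivisors_iff_right.2 fun q hq => ?_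
  obtain ⟨⟨r, s⟩, hrs⟩ := IsLocalization.surj (nonZeroDivisors R) q
  have hr : algebraMap R A r * x = 0 := Subtype.ext (by
    change algebraMap R (FractionRing R) r * x = 0
    rw [← hrs, mul_right_comm, hq, zero_mul])
  have hr₀ : algebraMap R (FractionRing R) r = 0 :=
    congrArg Subtype.val ((mem_nonZeroDivisors_iff_right.1 hx) _ hr)
  rwa [hr₀, (IsLocalization.map_units (FractionRing R) s).mul_left_eq_zero] at hrs

theorem weaklyArfStep_le_strictClosure {A : Subalgebra R (FractionRing R)}
    (hA : A ≤ strictClosure R) : weaklyArfStep A ≤ strictClosure R := by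
  have : Algebra.IsIntegral R A :=
    le_integralClosure_iff_isIntegral.1 (hA.trans strictClosure_le_integralClosure)
  refine Algebra.adjoin_le (Set.union_subset hA ?_)
  rintro q ⟨x, y, z, hx, ⟨u, hu, hux⟩, ⟨v, hv, hvx⟩, hq⟩
  have hq' : q = u * v * x := by
    refine (mul_cancel_right_mem_nonZeroDivisors (coe_mem_nonZeroDivisors_fractionRing hx)).1 ?_
    rw [hq, ← hux, ← hvx]
    ring
  rw [hq']
  exact mul_mul_mem_strictClosure (isIntegral_trans u hu) (isIntegral_trans v hv)
    (hA x.2) (hux ▸ hA y.2) (hvx ▸ hA z.2)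

variable (R) in
theorem weaklyArfClosure_le_strictClosure : weaklyArfClosure R ≤ strictClosure R := by
  refine iSup_le fun n => ?_
  induction n with
  | zero => exact bot_le
  | succ n ih => exact weaklyArfStep_le_strictClosure ih

theorem weaklyArfClosure_le_integralClosure :
    weaklyArfClosure R ≤ integralClosure R (FractionRing R) :=
  (weaklyArfClosure_le_strictClosure R).trans strictClosure_le_integralClosure

theorem mul_mul_mem_weaklyArfClosure {x u v : FractionRing R}
    (hx₀ : x ∈ nonZeroDivisors (FractionRing R)) (hu : IsIntegral R u) (hv : IsIntegral R v)
    (hx : x ∈ weaklyArfClosure R) (hux : u * x ∈ weaklyArfClosure R)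
    (hvx : v * x ∈ weaklyArfClosure R) : u * v * x ∈ weaklyArfClosure R := by
  simp only [mem_weaklyArfClosure] at *
  obtain ⟨m₁, h₁⟩ := hx
  obtain ⟨m₂, h₂⟩ := hux
  obtain ⟨m₃, h₃⟩ := hvx
  let m := m₁ + m₂ + m₃
  let x' : weaklyArfTower R m := ⟨x, weaklyArfTower_mono R (by omega) h₁⟩
  let y : weaklyArfTower R m := ⟨u * x, weaklyArfTower_mono R (by omega) h₂⟩
  let z : weaklyArfTower R m := ⟨v * x, weaklyArfTower_mono R (by omega) h₃⟩
  have hx' : x' ∈ nonZeroDivisors (weaklyArfTower R m) :=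
    comap_nonZeroDivisors_le_of_injective (f := (weaklyArfTower R m).val)
      Subtype.val_injective hx₀
  refine ⟨m + 1, Algebra.subset_adjoin (Or.inr
    ⟨x', y, z, hx', ⟨u, hu.tower_top, rfl⟩, ⟨v, hv.tower_top, rfl⟩, ?_⟩)⟩
  change u * v * x * x = u * x * (v * x)
  ring

end Closures

section Contraction

variable (R P : Type*) [CommRing R] [IsDomain R] [CommRing P] [IsDomain P] [Algebra R P]
  [FaithfulSMul R P]

/-- The embedding of the fraction field of a subring `R` of a domain `P` into that of `P`. -/
noncomputable def fractionRingHom : FractionRing R →ₐ[R] FractionRing P :=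
  IsFractionRing.liftAlgHom (g := Algebra.ofId R (FractionRing P))
    (FaithfulSMul.algebraMap_injective R (FractionRing P))

theorem fractionRingHom_injective : Function.Injective (fractionRingHom R P) :=
  (fractionRingHom R P).toRingHom.injective

/-- The contraction to `P` of an intermediate ring `A` of the fraction field of `R`, that is
`A ∩ P` inside the fraction field of `P`. -/
noncomputable def contraction (A : Subalgebra R (FractionRing R)) : Subalgebra R P :=
  (A.map (fractionRingHom R P)).comap (IsScalarTower.toAlgHom R P (FractionRing P))

variable {R P}

theorem mem_contraction {A : Subalgebra R (FractionRing R)} {f : P} :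
    f ∈ contraction R P A ↔ ∃ q ∈ A, fractionRingHom R P q = algebraMap P (FractionRing P) f :=
  Iff.rfl

theorem contraction_mono {A B : Subalgebra R (FractionRing R)} (h : A ≤ B) :
    contraction R P A ≤ contraction R P B :=
  (Subalgebra.gc_map_comap _).monotone_u (Subalgebra.map_mono h)

variable (R P) in
theorem contraction_bot : contraction R P ⊥ = ⊥ := by
  refine le_bot_iff.1 fun f hf => ?_
  rw [contraction, Algebra.map_bot] at hf
  obtain ⟨r, hr⟩ := Algebra.mem_bot.1 hf
  exact Algebra.mem_bot.2 ⟨r, IsFractionRing.injective P (FractionRing P) hr⟩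

theorem exists_algebraMap_eq_fractionRingHom [IsIntegrallyClosed P] {q : FractionRing R}
    (hq : IsIntegral R q) : ∃ f : P, algebraMap P (FractionRing P) f = fractionRingHom R P q :=
  IsIntegrallyClosed.isIntegral_iff.1 (hq.map (fractionRingHom R P)).tower_top

theorem map_eq_map_contraction [IsIntegrallyClosed P] {A : Subalgebra R (FractionRing R)}
    (hA : A ≤ integralClosure R (FractionRing R)) :
    (contraction R P A).map (IsScalarTower.toAlgHom R P (FractionRing P)) =
      A.map (fractionRingHom R P) := by
  refine Subalgebra.map_comap_eq_self ?_
  rintro _ ⟨q, hq, rfl⟩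
  exact exists_algebraMap_eq_fractionRingHom (hA hq)

theorem eq_of_contraction_eq [IsIntegrallyClosed P] {A B : Subalgebra R (FractionRing R)}
    (hA : A ≤ integralClosure R (FractionRing R)) (hB : B ≤ integralClosure R (FractionRing R))
    (h : contraction R P A = contraction R P B) : A = B := by
  refine Subalgebra.map_injective (fractionRingHom_injective R P) ?_
  rw [← map_eq_map_contraction hA, ← map_eq_map_contraction hB, h]

variable (P) in
/-- An intermediate ring that is integral over `R` lies inside every normal overring `P` of `R`,
so it is its own contraction. -/
noncomputable def equivContraction [IsIntegrallyClosed P] {A : Subalgebra R (FractionRing R)}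
    (hA : A ≤ integralClosure R (FractionRing R)) : A ≃ₐ[R] contraction R P A :=
  (A.equivMapOfInjective _ (fractionRingHom_injective R P)).trans <|
    (Subalgebra.equivOfEq _ _ (map_eq_map_contraction hA).symm).trans <|
      ((contraction R P A).equivMapOfInjective _ (IsFractionRing.injective P (FractionRing P))).symm

theorem algebraMap_equivContraction [IsIntegrallyClosed P] {A : Subalgebra R (FractionRing R)}
    (hA : A ≤ integralClosure R (FractionRing R)) (q : A) :
    algebraMap P (FractionRing P) (equivContraction P hA q) = fractionRingHom R P q :=
  congrArg Subtype.val (((contraction R P A).equivMapOfInjective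
    (IsScalarTower.toAlgHom R P (FractionRing P))
    (IsFractionRing.injective P (FractionRing P))).apply_symm_apply _)

/-- The form descends to a map on `P ⊗[R] P`, in which `f ⊗ 1 = 1 ⊗ f`. -/
theorem apply_one_eq_of_mem_contraction_strictClosure [IsIntegrallyClosed P] {M : Type*}
    [AddCommMonoid M] (B : P →+ P →+ M)
    (hB : ∀ (r : R) (f g : P), B (r • f) g = B f (r • g))
    {f : P} (hf : f ∈ contraction R P (strictClosure R)) : B f 1 = B 1 f := by
  let φ : integralClosure R (FractionRing R) →ₐ[R] P :=
    (contraction R P _).val.comp (equivContraction P le_rfl).toAlgHom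
  obtain ⟨_, ⟨s, hs, rfl⟩, hsf⟩ := mem_contraction.1 hf
  have hφs : φ s = f := IsFractionRing.injective P (FractionRing P)
    ((algebraMap_equivContraction le_rfl s).trans hsf)
  let B' := TensorProduct.liftAddHom (R := R)
    ((B.compl₂ φ.toAddMonoidHom).comp φ.toAddMonoidHom) fun r x y => by
      simpa using hB r (φ x) (φ y)
  have h : B (φ s) (φ 1) = B (φ 1) (φ s) := congrArg B' (mem_strictClosureIn.1 hs)
  rwa [map_one, hφs] at h

theorem mul_mul_mem_contraction_weaklyArfClosure [Algebra.IsIntegral R P] {x u v : P}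
    (hx₀ : x ≠ 0) (hx : x ∈ contraction R P (weaklyArfClosure R))
    (hux : u * x ∈ contraction R P (weaklyArfClosure R))
    (hvx : v * x ∈ contraction R P (weaklyArfClosure R)) :
    u * v * x ∈ contraction R P (weaklyArfClosure R) := by
  obtain ⟨x', hx', hxx'⟩ := mem_contraction.1 hx
  obtain ⟨y, hy, hyux⟩ := mem_contraction.1 hux
  obtain ⟨z, hz, hzvx⟩ := mem_contraction.1 hvx
  have hx'₀ : x' ≠ 0 := by
    rintro rfl
    rw [map_zero, eq_comm, FaithfulSMul.algebraMap_eq_zero_iff] at hxx'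
    exact hx₀ hxx'
  have map_div {y : FractionRing R} {u : P}
      (hy : fractionRingHom R P y = algebraMap P (FractionRing P) (u * x)) :
      fractionRingHom R P (y / x') = algebraMap P (FractionRing P) u := by
    rw [map_div₀, div_eq_iff (by simpa using hx'₀), hy, hxx', map_mul]
  have isIntegral_div {y : FractionRing R} {u : P}
      (hy : fractionRingHom R P y = algebraMap P (FractionRing P) (u * x)) :
      IsIntegral R (y / x') := by
    rw [← isIntegral_algHom_iff _ (fractionRingHom_injective R P), map_div hy]
    exact (Algebra.IsIntegral.isIntegral u).algebraMap
  refine mem_contraction.2 ⟨y / x' * (z / x') * x', mul_mul_mem_weaklyArfClosure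
    (mem_nonZeroDivisors_of_ne_zero hx'₀) (isIntegral_div hyux) (isIntegral_div hzvx) hx' ?_ ?_, ?_⟩
  · rwa [div_mul_cancel₀ _ hx'₀]
  · rwa [div_mul_cancel₀ _ hx'₀]
  · rw [map_mul, map_mul, map_div hyux, map_div hzvx, hxx', map_mul, map_mul]

theorem weaklyArfClosure_eq_strictClosure_of_contraction_le [IsIntegrallyClosed P]
    (h : contraction R P (strictClosure R) ≤ contraction R P (weaklyArfClosure R)) :
    weaklyArfClosure R = strictClosure R :=
  eq_of_contraction_eq weaklyArfClosure_le_integralClosure strictClosure_le_integralClosure <|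
    le_antisymm (contraction_mono (weaklyArfClosure_le_strictClosure R)) h

variable (R P) in
/-- The weakly Arf closure is isomorphic to its contraction to a normal overring. -/
noncomputable def weaklyArfClosureEquiv [IsIntegrallyClosed P] :
    weaklyArfClosure R ≃+* contraction R P (weaklyArfClosure R) :=
  (equivContraction P weaklyArfClosure_le_integralClosure).toRingEquiv

end Contraction

section MonomialSubalgebra

open MvPolynomial

variable {σ : Type*} (k : Type*)

/-- The algebra `k[S]` of an additive monoid `S` of exponents, inside the polynomial ring. -/
noncomputable def monomialSubalgebra [CommSemiring k] (S : AddSubmonoid (σ →₀ ℕ)) :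
    Subalgebra k (MvPolynomial σ k) :=
  (restrictSupport k (S : Set (σ →₀ ℕ))).toSubalgebra
    ((monomial_mem_restrictSupport k).2 (Or.inl S.zero_mem)) fun _ _ hf hg =>
      restrictSupport_mono k (Set.add_subset_iff.2 fun _ hv _ hw => S.add_mem hv hw)
        (restrictSupport_add k (S : Set (σ →₀ ℕ)) S ▸ Submodule.mul_mem_mul hf hg)

section CommSemiring

variable {k} [CommSemiring k] {S : AddSubmonoid (σ →₀ ℕ)}

theorem mem_monomialSubalgebra {f : MvPolynomial σ k} :
    f ∈ monomialSubalgebra k S ↔ ∀ w, coeff w f ≠ 0 → w ∈ S := by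
  change f ∈ restrictSupport k (S : Set (σ →₀ ℕ)) ↔ _
  simp [mem_restrictSupport_iff, Set.subset_def]

theorem monomial_mem_monomialSubalgebra [Nontrivial k] {w : σ →₀ ℕ} :
    monomial w (1 : k) ∈ monomialSubalgebra k S ↔ w ∈ S :=
  (monomial_mem_restrictSupport k).trans (or_iff_left one_ne_zero)

theorem mul_monomial_mem_monomialSubalgebra_iff {w : σ →₀ ℕ} (hw : w ∉ S)
    (hSw : ∀ v ∈ S, v ≠ 0 → v + w ∈ S) {f : MvPolynomial σ k} (hf : f ∈ monomialSubalgebra k S) :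
    f * monomial w 1 ∈ monomialSubalgebra k S ↔ constantCoeff f = 0 := by
  rw [mem_monomialSubalgebra] at hf ⊢
  refine ⟨fun h => ?_, fun h v hv => ?_⟩
  · by_contra hf₀
    refine hw (h w ?_)
    simpa [coeff_mul_monomial', constantCoeff_eq] using hf₀
  · rw [coeff_mul_monomial', mul_one, ite_ne_right_iff] at hv
    rw [← tsub_add_cancel_of_le hv.1]
    refine hSw _ (hf _ hv.2) fun hvw => hv.2 ?_
    rwa [hvw]

variable (k) in
theorem adjoin_monomial_image (E : Set (σ →₀ ℕ)) :
    Algebra.adjoin k ((monomial · (1 : k)) '' E) =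
      monomialSubalgebra k (AddSubmonoid.closure E) := by
  refine le_antisymm (Algebra.adjoin_le ?_) ?_
  · rintro _ ⟨w, hw, rfl⟩
    exact (monomial_mem_restrictSupport k).2 (Or.inl (AddSubmonoid.subset_closure hw))
  · change restrictSupport k _ ≤ Subalgebra.toSubmodule (Algebra.adjoin k _)
    rw [restrictSupport_eq_span, Submodule.span_le, Set.image_subset_iff]
    intro w hw
    change monomial w 1 ∈ Algebra.adjoin k _
    induction hw using AddSubmonoid.closure_induction with
    | mem w hw => exact Algebra.subset_adjoin ⟨w, hw, rfl⟩
    | zero => exact one_mem (Algebra.adjoin k _)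
    | add v w _ _ hv hw =>
      simpa [monomial_mul] using mul_mem hv hw

open Classical in
/-- The additive projection of the polynomial ring onto the span of the monomials with exponent
in `D`. -/
noncomputable def supportProjection (D : Set (σ →₀ ℕ)) :
    MvPolynomial σ k →+ MvPolynomial σ k :=
  (AddMonoidAlgebra.coeffAddEquiv (R := k)).symm.toAddMonoidHom.comp <|
    (Finsupp.filterAddHom (· ∈ D)).comp (AddMonoidAlgebra.coeffAddEquiv (R := k)).toAddMonoidHom

open Classical in
theorem coeff_supportProjection (D : Set (σ →₀ ℕ)) (f : MvPolynomial σ k)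
    (a : σ →₀ ℕ) : coeff a (supportProjection D f) = if a ∈ D then coeff a f else 0 :=
  Finsupp.filter_apply _ _ _

theorem coeff_supportProjection_mul {D : Set (σ →₀ ℕ)} {w : σ →₀ ℕ}
    (hD : ∀ h ∈ S, ∀ a, a + h ≤ w → (a + h ∈ D ↔ a ∈ D))
    {r : MvPolynomial σ k} (hr : r ∈ monomialSubalgebra k S) (f : MvPolynomial σ k)
    {a : σ →₀ ℕ} (ha : a ≤ w) :
    coeff a (supportProjection D (r * f)) = coeff a (r * supportProjection D f) := by
  classical
  simp only [coeff_supportProjection, coeff_mul, mul_ite, mul_zero]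
  rw [Finset.ite_sum_zero]
  refine Finset.sum_congr rfl fun p hp => ?_
  obtain rfl := Finset.HasAntidiagonal.mem_antidiagonal.1 hp
  by_cases hp₁ : coeff p.1 r = 0
  · simp [hp₁]
  · rw [add_comm, hD _ (mem_monomialSubalgebra.1 hr _ hp₁) _ (add_comm p.1 p.2 ▸ ha)]

end CommSemiring

theorem isIntegral_monomialSubalgebra [CommRing k] {S : AddSubmonoid (σ →₀ ℕ)}
    (hS : ∀ i, ∃ n ≠ 0, Finsupp.single i n ∈ S) :
    Algebra.IsIntegral (monomialSubalgebra k S) (MvPolynomial σ k) := by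
  refine ⟨fun f => ?_⟩
  induction f using MvPolynomial.induction_on with
  | C c => exact isIntegral_algebraMap (x := algebraMap k (monomialSubalgebra k S) c)
  | add f g hf hg => exact hf.add hg
  | mul_X f i hf =>
    obtain ⟨n, hn, hi⟩ := hS i
    have hX : X i ^ n ∈ monomialSubalgebra k S :=
      X_pow_eq_monomial (R := k) ▸ (monomial_mem_restrictSupport k).2 (Or.inl hi)
    exact hf.mul (.of_pow (Nat.pos_of_ne_zero hn)
      (isIntegral_algebraMap (x := (⟨X i ^ n, hX⟩ : monomialSubalgebra k S))))

theorem isNoetherianRing_monomialSubalgebra [CommRing k] [IsNoetherianRing k]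
    {S : AddSubmonoid (σ →₀ ℕ)} (hS : S.FG) : IsNoetherianRing (monomialSubalgebra k S) := by
  obtain ⟨E, rfl⟩ := hS
  classical
  rw [← adjoin_monomial_image, ← Finset.coe_image]
  exact isNoetherianRing_of_fg (Subalgebra.fg_adjoin_finset _)

variable {k} [CommRing k] [IsDomain k]

/-- The bilinear form `(f, g) ↦ coeff w (π f * g)`, with `π` the projection onto the exponents in
`D`, is balanced over `k[S]`. -/
theorem coeff_eq_zero_of_mem_contraction_strictClosure
    [IsIntegrallyClosed (MvPolynomial σ k)]
    {S : AddSubmonoid (σ →₀ ℕ)} {D : Set (σ →₀ ℕ)} {w : σ →₀ ℕ}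
    (hD : ∀ h ∈ S, ∀ a, a + h ≤ w → (a + h ∈ D ↔ a ∈ D)) (hw : w ∈ D) (h₀ : 0 ∉ D)
    {f : MvPolynomial σ k}
    (hf : f ∈ contraction (monomialSubalgebra k S) (MvPolynomial σ k)
      (strictClosure (monomialSubalgebra k S))) : coeff w f = 0 := by
  classical
  obtain ⟨B, B_apply⟩ : ∃ B : MvPolynomial σ k →+ MvPolynomial σ k →+ k,
      ∀ f g, B f g = coeff w (supportProjection D f * g) :=
    ⟨(AddMonoidHom.mul.comp (supportProjection D)).compr₂ (coeffAddMonoidHom w), fun _ _ => rfl⟩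
  have balanced (r : monomialSubalgebra k S) (g₁ g₂ : MvPolynomial σ k) :
      B (r • g₁) g₂ = B g₁ (r • g₂) := by
    rw [B_apply, B_apply, Subalgebra.smul_def, Subalgebra.smul_def, smul_eq_mul, smul_eq_mul,
      mul_left_comm, ← mul_assoc, coeff_mul, coeff_mul]
    refine Finset.sum_congr rfl fun p hp => ?_
    rw [coeff_supportProjection_mul hD r.2 g₁]
    exact Finset.HasAntidiagonal.mem_antidiagonal.1 hp ▸ le_self_add
  have projection_one : supportProjection D (1 : MvPolynomial σ k) = 0 := by
    ext a
    rw [coeff_supportProjection, coeff_one, coeff_zero, ite_eq_right_iff, ite_eq_right_iff]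
    rintro ha rfl
    exact absurd ha h₀
  have := apply_one_eq_of_mem_contraction_strictClosure (R := monomialSubalgebra k S) B balanced hf
  simpa [B_apply, projection_one, coeff_supportProjection, hw] using this

variable (k) in
/-- The monomial `x ^ w` bounds the depth at the augmentation ideal by one, while this ideal
strictly contains the nonzero prime ideal lying under `X j`. -/
theorem not_serreCondition_two_monomialSubalgebra {S : AddSubmonoid (σ →₀ ℕ)} {j : σ}
    {s t w : σ →₀ ℕ} (ht : t ∈ S) (htj : t j ≠ 0) (hs : s ∈ S) (hs₀ : s ≠ 0) (hsj : s j = 0)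
    (hw : w ∉ S) (hSw : ∀ v ∈ S, v ≠ 0 → v + w ∈ S) :
    ¬ SerreCondition 2 (monomialSubalgebra k S) := by
  let x (v : σ →₀ ℕ) (hv : v ∈ S) : monomialSubalgebra k S :=
    ⟨monomial v 1, monomial_mem_monomialSubalgebra.2 hv⟩
  let p : Ideal (monomialSubalgebra k S) :=
    (Ideal.span {(X j : MvPolynomial σ k)}).comap (monomialSubalgebra k S).val
  let M : Ideal (monomialSubalgebra k S) :=
    RingHom.ker (constantCoeff.comp (monomialSubalgebra k S).val.toRingHom)
  have mem_p {f : monomialSubalgebra k S} : f ∈ p ↔ X j ∣ (f : MvPolynomial σ k) :=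
    Ideal.mem_span_singleton
  have mem_M {f : monomialSubalgebra k S} : f ∈ M ↔ constantCoeff (f : MvPolynomial σ k) = 0 :=
    Iff.rfl
  have : (Ideal.span {(X j : MvPolynomial σ k)}).IsPrime :=
    (Ideal.span_singleton_prime (X_ne_zero j)).2 X_prime
  have : p.IsPrime := Ideal.comap_isPrime _ _
  have : M.IsPrime := RingHom.ker_isPrime _
  have x_ne_zero {v : σ →₀ ℕ} (hv : v ∈ S) : x v hv ≠ 0 := fun h => by
    simpa [x] using congrArg Subtype.val h
  have hp : ⊥ < p := bot_lt_iff_ne_bot.2 <|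
    (Submodule.ne_bot_iff _).2 ⟨x t ht, mem_p.2 (X_dvd_monomial.2 (Or.inr htj)), x_ne_zero ht⟩
  have hpM : p < M := by
    refine SetLike.lt_iff_le_and_exists.2 ⟨fun f hf => ?_, x s hs, ?_, ?_⟩
    · obtain ⟨g, hg⟩ := mem_p.1 hf
      simp [mem_M, hg]
    · classical simp [mem_M, x, constantCoeff_monomial, hs₀]
    · simp [mem_p, x, X_dvd_monomial, hsj]
  refine not_serreCondition_two_of_mem_iff_dvd_mul hp hpM (x_ne_zero hs)
    (b := x (s + w) (hSw s hs hs₀)) fun ⟨f, hf⟩ => ?_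
  have mul_eq : f * monomial (s + w) 1 = monomial s 1 * (f * monomial w 1) := by
    rw [mul_left_comm, monomial_mul, one_mul]
  rw [mem_M, ← mul_monomial_mem_monomialSubalgebra_iff hw hSw hf]
  refine ⟨fun hfw => ⟨⟨_, hfw⟩, Subtype.ext mul_eq⟩, ?_⟩
  rintro ⟨g, hg⟩
  have hfg : f * monomial w 1 = (g : MvPolynomial σ k) :=
    mul_left_cancel₀ (a := monomial s 1) (monomial_eq_zero.not.2 one_ne_zero)
      (mul_eq.symm.trans (congrArg Subtype.val hg))
  exact hfg ▸ g.2

end MonomialSubalgebra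

section Exponents

/-- The exponent of the monomial `X ^ i * Y ^ j`. -/
noncomputable def bidegree (i j : ℕ) : Fin 2 →₀ ℕ :=
  Finsupp.single 0 i + Finsupp.single 1 j

@[simp]
theorem bidegree_apply_zero (i j : ℕ) : bidegree i j 0 = i := by
  simp [bidegree]

@[simp]
theorem bidegree_apply_one (i j : ℕ) : bidegree i j 1 = j := by
  simp [bidegree]

theorem exponent_ext_iff {v w : Fin 2 →₀ ℕ} : v = w ↔ v 0 = w 0 ∧ v 1 = w 1 := by
  rw [DFunLike.ext_iff, Fin.forall_fin_two]

theorem exponent_le_iff {v w : Fin 2 →₀ ℕ} : v ≤ w ↔ v 0 ≤ w 0 ∧ v 1 ≤ w 1 := by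
  rw [Finsupp.le_def, Fin.forall_fin_two]

theorem nsmul_bidegree (c i j : ℕ) : c • bidegree i j = bidegree (c * i) (c * j) := by
  simp [exponent_ext_iff]

theorem monomial_bidegree {k : Type*} [CommSemiring k] (i j : ℕ) :
    MvPolynomial.monomial (bidegree i j) (1 : k) = MvPolynomial.X 0 ^ i * MvPolynomial.X 1 ^ j := by
  simp [bidegree, MvPolynomial.X_pow_eq_monomial, MvPolynomial.monomial_mul]

/-- The exponents of the monomials in `k[X ^ n, X * Y ^ (n - 1), Y ^ n]`. -/
noncomputable def generatorMonoid (n : ℕ) : AddSubmonoid (Fin 2 →₀ ℕ) :=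
  AddSubmonoid.closure {bidegree n 0, bidegree 1 (n - 1), bidegree 0 n}

theorem bidegree_self_zero_mem_generatorMonoid (n : ℕ) : bidegree n 0 ∈ generatorMonoid n :=
  AddSubmonoid.subset_closure (by simp)

theorem bidegree_zero_self_mem_generatorMonoid (n : ℕ) : bidegree 0 n ∈ generatorMonoid n :=
  AddSubmonoid.subset_closure (by simp)

theorem apply_one_of_mem_generatorMonoid {n : ℕ} {w : Fin 2 →₀ ℕ} (hw : w ∈ generatorMonoid n) :
    w 1 = 0 ∨ w 1 = n - 1 ∨ w 1 = n ∨ 2 * n - 2 ≤ w 1 := by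
  induction hw using AddSubmonoid.closure_induction with
  | mem w hw => rcases hw with rfl | rfl | rfl <;> simp
  | zero => simp
  | add v w _ _ hv hw =>
    rw [Finsupp.add_apply]
    omega

/-- The exponents of the monomials in the strict closure of `k[X ^ n, X * Y ^ (n - 1), Y ^ n]`
for `n = 4` and `n = 5`: among the monomials of degree divisible by `n` with `Y`-exponent `0` or at
least `n - 1`, only `X ^ i * Y ^ (2 * n - i)` with `3 ≤ i < n` are missing. -/
def arfExponents (n : ℕ) : AddSubmonoid (Fin 2 →₀ ℕ) where
  carrier := {w | n ∣ w 0 + w 1 ∧ (w 1 = 0 ∨ n ≤ w 1 + 1) ∧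
    ¬(3 ≤ w 0 ∧ w 0 < n ∧ w 0 + w 1 = 2 * n)}
  zero_mem' := by simp
  add_mem' := by
    rintro v w ⟨hv, hv₁, hv₂⟩ ⟨hw, hw₁, hw₂⟩
    obtain ⟨c, hc⟩ := hv
    obtain ⟨d, hd⟩ := hw
    simp only [Set.mem_ofPred_eq, Finsupp.add_apply]
    refine ⟨⟨c + d, by rw [mul_add]; omega⟩, by omega, ?_⟩
    rintro ⟨h₃, hn, h⟩
    have hcd : c + d = 2 :=
      Nat.eq_of_mul_eq_mul_left (by omega : 0 < n) (by rw [mul_add]; omega)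
    obtain ⟨rfl, rfl⟩ | ⟨rfl, rfl⟩ | ⟨rfl, rfl⟩ :
        c = 0 ∧ d = 2 ∨ c = 1 ∧ d = 1 ∨ c = 2 ∧ d = 0 := by omega
    all_goals omega

theorem mem_arfExponents {n : ℕ} {w : Fin 2 →₀ ℕ} : w ∈ arfExponents n ↔
    n ∣ w 0 + w 1 ∧ (w 1 = 0 ∨ n ≤ w 1 + 1) ∧ ¬(3 ≤ w 0 ∧ w 0 < n ∧ w 0 + w 1 = 2 * n) :=
  Iff.rfl

theorem mem_of_bidegree_mem {n i j : ℕ} {T : AddSubmonoid (Fin 2 →₀ ℕ)}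
    (hX : bidegree n 0 ∈ T) (hY : bidegree 0 n ∈ T) (hij : bidegree i j ∈ T) {w : Fin 2 →₀ ℕ}
    (hi : i ≤ w 0) (hj : j ≤ w 1) (hni : n ∣ w 0 - i) (hnj : n ∣ w 1 - j) : w ∈ T := by
  obtain ⟨c, hc⟩ := hni
  obtain ⟨d, hd⟩ := hnj
  have hw : w = bidegree i j + c • bidegree n 0 + d • bidegree 0 n := by
    simp only [exponent_ext_iff, Finsupp.add_apply, nsmul_bidegree, bidegree_apply_zero,
      bidegree_apply_one, mul_zero, add_zero, mul_comm _ n]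
    omega
  exact hw ▸ add_mem (add_mem hij (nsmul_mem hX c)) (nsmul_mem hY d)

theorem arfExponents_four : arfExponents 4 =
    AddSubmonoid.closure {bidegree 4 0, bidegree 1 3, bidegree 0 4, bidegree 7 5} := by
  refine le_antisymm (fun w hw => ?_) (AddSubmonoid.closure_le.2 ?_)
  · obtain ⟨hdvd, hw₁, hgap⟩ := hw
    set T := AddSubmonoid.closure {bidegree 4 0, bidegree 1 3, bidegree 0 4, bidegree 7 5}
    have hE : {bidegree 4 0, bidegree 1 3, bidegree 0 4, bidegree 7 5} ⊆ (T : Set _) :=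
      AddSubmonoid.subset_closure
    simp only [Set.insert_subset_iff, Set.singleton_subset_iff, SetLike.mem_coe] at hE
    obtain ⟨hX, hXY, hY, hZ⟩ := hE
    have hmul (c : ℕ) : bidegree (c * 1) (c * 3) ∈ T := nsmul_bidegree c 1 3 ▸ nsmul_mem hXY c
    obtain h | h | h | h | h : w 1 % 4 = 0 ∨ w 1 % 4 = 3 ∨ w 1 % 4 = 2 ∨
        w 1 = 5 ∨ w 1 % 4 = 1 ∧ 9 ≤ w 1 := by omega
    · exact mem_of_bidegree_mem hX hY (hmul 0) (by omega) (by omega) (by omega) (by omega)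
    · exact mem_of_bidegree_mem hX hY (hmul 1) (by omega) (by omega) (by omega) (by omega)
    · exact mem_of_bidegree_mem hX hY (hmul 2) (by omega) (by omega) (by omega) (by omega)
    · exact mem_of_bidegree_mem hX hY hZ (by omega) (by omega) (by omega) (by omega)
    · exact mem_of_bidegree_mem hX hY (hmul 3) (by omega) (by omega) (by omega) (by omega)
  · simp [Set.insert_subset_iff, mem_arfExponents]

theorem fg_arfExponents_four : (arfExponents 4).FG :=
  (AddSubmonoid.fg_iff _).2 ⟨_, arfExponents_four.symm, Set.toFinite _⟩

theorem arfExponents_five : arfExponents 5 = AddSubmonoid.closure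
    {bidegree 5 0, bidegree 1 4, bidegree 0 5, bidegree 9 6, bidegree 8 7, bidegree 4 11} := by
  refine le_antisymm (fun w hw => ?_) (AddSubmonoid.closure_le.2 ?_)
  · obtain ⟨hdvd, hw₁, hgap⟩ := hw
    set T := AddSubmonoid.closure
      {bidegree 5 0, bidegree 1 4, bidegree 0 5, bidegree 9 6, bidegree 8 7, bidegree 4 11}
    have hE : {bidegree 5 0, bidegree 1 4, bidegree 0 5, bidegree 9 6, bidegree 8 7,
        bidegree 4 11} ⊆ (T : Set _) :=
      AddSubmonoid.subset_closure
    simp only [Set.insert_subset_iff, Set.singleton_subset_iff, SetLike.mem_coe] at hE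
    obtain ⟨hX, hXY, hY, hZ₁, hZ₂, hZ₃⟩ := hE
    have hmul (c : ℕ) : bidegree (c * 1) (c * 4) ∈ T := nsmul_bidegree c 1 4 ▸ nsmul_mem hXY c
    obtain h | h | h | h | h | h | h : w 1 % 5 = 0 ∨ w 1 % 5 = 4 ∨ w 1 % 5 = 3 ∨ w 1 = 7 ∨
        w 1 % 5 = 2 ∧ 12 ≤ w 1 ∨ w 1 = 6 ∨ w 1 % 5 = 1 ∧ 11 ≤ w 1 := by omega
    · exact mem_of_bidegree_mem hX hY (hmul 0) (by omega) (by omega) (by omega) (by omega)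
    · exact mem_of_bidegree_mem hX hY (hmul 1) (by omega) (by omega) (by omega) (by omega)
    · exact mem_of_bidegree_mem hX hY (hmul 2) (by omega) (by omega) (by omega) (by omega)
    · exact mem_of_bidegree_mem hX hY hZ₂ (by omega) (by omega) (by omega) (by omega)
    · exact mem_of_bidegree_mem hX hY (hmul 3) (by omega) (by omega) (by omega) (by omega)
    · exact mem_of_bidegree_mem hX hY hZ₁ (by omega) (by omega) (by omega) (by omega)
    · exact mem_of_bidegree_mem hX hY hZ₃ (by omega) (by omega) (by omega) (by omega)
  · simp [Set.insert_subset_iff, mem_arfExponents]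

theorem fg_arfExponents_five : (arfExponents 5).FG :=
  (AddSubmonoid.fg_iff _).2 ⟨_, arfExponents_five.symm, Set.toFinite _⟩

end Exponents

section Plane

open MvPolynomial

theorem isIntegrallyClosed_mvPolynomial (σ k : Type*) [Finite σ] [CommRing k] [IsDomain k]
    [IsIntegrallyClosed k] : IsIntegrallyClosed (MvPolynomial σ k) := by
  obtain ⟨n, ⟨e⟩⟩ := Finite.exists_equiv_fin σ
  suffices IsIntegrallyClosed (MvPolynomial (Fin n) k) from
    .of_equiv (renameEquiv k e.symm).toRingEquiv
  clear e
  induction n with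
  | zero => exact .of_equiv (isEmptyRingEquiv k (Fin 0)).symm
  | succ n ih => exact .of_equiv (finSuccEquiv k n).symm.toRingEquiv

theorem add_mem_iff_of_mem_closure {M : Type*} [AddMonoid M] [Preorder M] [CanonicallyOrderedAdd M]
    {E D : Set M} {w : M} (hE : ∀ h ∈ E, ∀ a, a + h ≤ w → (a + h ∈ D ↔ a ∈ D)) :
    ∀ h ∈ AddSubmonoid.closure E, ∀ a, a + h ≤ w → (a + h ∈ D ↔ a ∈ D) := by
  intro h hh
  induction hh using AddSubmonoid.closure_induction with
  | mem h hh => exact hE h hh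
  | zero => simp
  | add g h _ _ hg hh =>
    intro a ha
    rw [← add_assoc] at ha ⊢
    rw [hh _ ha, hg _ (le_self_add.trans ha)]

variable {k : Type*} [CommRing k]

variable (k) in
/-- The ring `k[X ^ n, X * Y ^ (n - 1), Y ^ n]`. -/
noncomputable abbrev generatorSubalgebra (n : ℕ) : Subalgebra k (MvPolynomial (Fin 2) k) :=
  monomialSubalgebra k (generatorMonoid n)

theorem adjoin_eq_generatorSubalgebra (n : ℕ) :
    Algebra.adjoin k {X 0 ^ n, X 0 * X 1 ^ (n - 1), X 1 ^ n} =
      generatorSubalgebra k n := by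
  rw [generatorSubalgebra, generatorMonoid, ← adjoin_monomial_image]
  simp only [Set.image_insert_eq, Set.image_singleton, monomial_bidegree, pow_zero, pow_one,
    one_mul, mul_one]

theorem isIntegral_generatorSubalgebra {n : ℕ} (hn : n ≠ 0) :
    Algebra.IsIntegral (generatorSubalgebra k n) (MvPolynomial (Fin 2) k) := by
  refine isIntegral_monomialSubalgebra k (Fin.forall_fin_two.2 ⟨⟨n, hn, ?_⟩, ⟨n, hn, ?_⟩⟩)
  · simpa [bidegree] using bidegree_self_zero_mem_generatorMonoid n
  · simpa [bidegree] using bidegree_zero_self_mem_generatorMonoid n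

theorem exists_set_separating_zero_of_notMem_arfExponents {n : ℕ} (hn : n ≠ 0) {w : Fin 2 →₀ ℕ}
    (hw : w ∉ arfExponents n) : ∃ D : Set (Fin 2 →₀ ℕ), w ∈ D ∧ 0 ∉ D ∧
      ∀ h ∈ generatorMonoid n, ∀ a, a + h ≤ w → (a + h ∈ D ↔ a ∈ D) := by
  suffices ∃ D : Set (Fin 2 →₀ ℕ), w ∈ D ∧ 0 ∉ D ∧
      ∀ h ∈ ({bidegree n 0, bidegree 1 (n - 1), bidegree 0 n} : Set (Fin 2 →₀ ℕ)),
        ∀ a, a + h ≤ w → (a + h ∈ D ↔ a ∈ D) by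
    obtain ⟨D, hwD, h₀, hD⟩ := this
    exact ⟨D, hwD, h₀, add_mem_iff_of_mem_closure hD⟩
  simp only [Set.forall_mem_insert, Set.mem_singleton_iff, forall_eq]
  by_cases hdvd : n ∣ w 0 + w 1
  · by_cases hw₁ : w 1 = 0 ∨ n ≤ w 1 + 1
    · have hgap : 3 ≤ w 0 ∧ w 0 < n ∧ w 0 + w 1 = 2 * n :=
        of_not_not fun h => hw ⟨hdvd, hw₁, h⟩
      refine ⟨{a | a = w ∨ a + bidegree 1 (n - 1) = w ∨ a + bidegree 0 n = w}, ?_, ?_, ?_⟩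
      · simp
      all_goals
        simp only [Set.mem_ofPred_eq, exponent_ext_iff, exponent_le_iff, Finsupp.add_apply,
          Finsupp.zero_apply, bidegree_apply_zero, bidegree_apply_one]
      · omega
      · refine ⟨?_, ?_, ?_⟩ <;> intro a ha <;> omega
    · refine ⟨{a | a 1 ≠ 0}, ?_, ?_, ?_⟩ <;>
        simp only [Set.mem_ofPred_eq, exponent_le_iff, Finsupp.add_apply, bidegree_apply_zero,
          bidegree_apply_one]
      · omega
      · simp
      · refine ⟨?_, ?_, ?_⟩ <;> intro a ha <;> omega
  · refine ⟨{a | ¬ n ∣ a 0 + a 1}, hdvd, by simp, ?_⟩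
    simp only [Set.mem_ofPred_eq, Finsupp.add_apply, bidegree_apply_zero, bidegree_apply_one,
      not_iff_not]
    refine ⟨?_, ?_, ?_⟩ <;> intro a _ <;> rw [← Nat.dvd_add_self_right (m := n) (n := a 0 + a 1)]
    all_goals
      refine iff_of_eq (congrArg (n ∣ ·) ?_)
      omega

theorem mem_of_mem_contraction_strictClosure [IsDomain k]
    [IsIntegrallyClosed (MvPolynomial (Fin 2) k)] {n : ℕ} (hn : n ≠ 0) {f : MvPolynomial (Fin 2) k}
    (hf : f ∈ contraction (generatorSubalgebra k n) (MvPolynomial (Fin 2) k)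
      (strictClosure (generatorSubalgebra k n))) :
    f ∈ monomialSubalgebra k (arfExponents n) := by
  refine mem_monomialSubalgebra.2 fun w hfw => by_contra fun hw => hfw ?_
  obtain ⟨D, hwD, h₀, hD⟩ := exists_set_separating_zero_of_notMem_arfExponents hn hw
  exact coeff_eq_zero_of_mem_contraction_strictClosure hD hwD h₀ hf

end Plane

section PlaneClosure

open MvPolynomial

variable {k : Type*} [CommRing k]

theorem monomialSubalgebra_closure_le_iff {σ : Type*} {E : Set (σ →₀ ℕ)}
    {A : Subalgebra k (MvPolynomial σ k)} :
    monomialSubalgebra k (AddSubmonoid.closure E) ≤ A ↔ ∀ w ∈ E, monomial w 1 ∈ A := by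
  rw [← adjoin_monomial_image, Algebra.adjoin_le_iff, Set.image_subset_iff]
  rfl

variable [IsDomain k]

variable (k) in
/-- The weakly Arf closure of `k[X ^ n, X * Y ^ (n - 1), Y ^ n]`, as a subring of the polynomial
ring. -/
noncomputable def generatorArfClosure (n : ℕ) : Subalgebra k (MvPolynomial (Fin 2) k) :=
  (contraction (generatorSubalgebra k n) (MvPolynomial (Fin 2) k)
    (weaklyArfClosure (generatorSubalgebra k n))).restrictScalars k

theorem mem_generatorArfClosure {n : ℕ} {f : MvPolynomial (Fin 2) k} :
    f ∈ generatorArfClosure k n ↔ f ∈ contraction (generatorSubalgebra k n)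
      (MvPolynomial (Fin 2) k) (weaklyArfClosure (generatorSubalgebra k n)) :=
  Iff.rfl

variable (k) in
theorem generators_mem_generatorArfClosure (n : ℕ) :
    X 0 ^ n ∈ generatorArfClosure k n ∧ X 0 * X 1 ^ (n - 1) ∈ generatorArfClosure k n ∧
      X 1 ^ n ∈ generatorArfClosure k n := by
  have h {f : MvPolynomial (Fin 2) k} (hf : f ∈ ({X 0 ^ n, X 0 * X 1 ^ (n - 1), X 1 ^ n} : Set _)) :
      f ∈ generatorArfClosure k n :=
    (contraction (generatorSubalgebra k n) (MvPolynomial (Fin 2) k) _).algebraMap_mem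
      ⟨f, adjoin_eq_generatorSubalgebra (k := k) n ▸ Algebra.subset_adjoin hf⟩
  exact ⟨h (by simp), h (by simp), h (by simp)⟩

theorem mul_mul_mem_generatorArfClosure {n : ℕ} (hn : n ≠ 0) {x u v : MvPolynomial (Fin 2) k}
    (hx₀ : x ≠ 0) (hx : x ∈ generatorArfClosure k n) (hux : u * x ∈ generatorArfClosure k n)
    (hvx : v * x ∈ generatorArfClosure k n) : u * v * x ∈ generatorArfClosure k n := by
  have := isIntegral_generatorSubalgebra (k := k) hn
  exact mem_generatorArfClosure.2 <| mul_mul_mem_contraction_weaklyArfClosure hx₀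
    (mem_generatorArfClosure.1 hx) (mem_generatorArfClosure.1 hux) (mem_generatorArfClosure.1 hvx)

theorem monomialSubalgebra_arfExponents_four_le :
    monomialSubalgebra k (arfExponents 4) ≤ generatorArfClosure k 4 := by
  obtain ⟨hX, hXY, hY⟩ := generators_mem_generatorArfClosure k 4
  have h₇₅ : X 0 ^ 7 * X 1 ^ 5 ∈ generatorArfClosure k 4 := by
    have hu : X 0 ^ 3 * X 1 * (X 0 * X 1 ^ 3) ∈ generatorArfClosure k 4 := by
      convert mul_mem hX hY using 1
      ring
    convert mul_mul_mem_generatorArfClosure four_ne_zero (by simp [X_ne_zero]) hXY hu hu using 1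
    ring
  rw [arfExponents_four, monomialSubalgebra_closure_le_iff]
  simpa [monomial_bidegree] using ⟨hX, hXY, hY, h₇₅⟩

/-- No Arf fraction of monomials yields `X ^ 8 * Y ^ 7`; the factorization
`(X ^ 2 - X * Y + Y ^ 2) * (X + Y) = X ^ 3 + Y ^ 3` provides one with a binomial denominator, whose
other monomials are already known to lie in the closure. -/
theorem X_pow_eight_mul_X_pow_seven_mem_generatorArfClosure
    (h₉₆ : X 0 ^ 9 * X 1 ^ 6 ∈ generatorArfClosure k 5)
    (h₄₁₁ : X 0 ^ 4 * X 1 ^ 11 ∈ generatorArfClosure k 5) :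
    X 0 ^ 8 * X 1 ^ 7 ∈ generatorArfClosure k 5 := by
  obtain ⟨hX, hXY, hY⟩ := generators_mem_generatorArfClosure k 5
  have hx₀ : X 1 ^ 5 + X 0 * X 1 ^ 4 ≠ (0 : MvPolynomial (Fin 2) k) := fun h => by
    simpa using congrArg (aeval ![(0 : k), 1]) h
  have hu : (X 0 ^ 4 * X 1 - X 0 ^ 3 * X 1 ^ 2 + X 0 ^ 2 * X 1 ^ 3) *
      (X 1 ^ 5 + X 0 * X 1 ^ 4) ∈ generatorArfClosure k 5 := by
    convert add_mem (mul_mem hX hY) (pow_mem hXY 2) using 1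
    ring
  have huu := mul_mul_mem_generatorArfClosure (OfNat.ofNat_ne_zero 5) hx₀ (add_mem hY hXY) hu hu
  have hrest : X 0 ^ 9 * X 1 ^ 6 + X 0 ^ 5 * (X 0 * X 1 ^ 4) ^ 2 +
      X 0 ^ 5 * (X 0 * X 1 ^ 4) * X 1 ^ 5 - X 0 ^ 5 * (X 1 ^ 5) ^ 2 + X 0 ^ 4 * X 1 ^ 11 ∈
        generatorArfClosure k 5 :=
    add_mem (sub_mem (add_mem (add_mem h₉₆ (mul_mem hX (pow_mem hXY 2)))
      (mul_mem (mul_mem hX hXY) hY)) (mul_mem hX (pow_mem hY 2))) h₄₁₁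
  convert sub_mem hrest huu using 1
  ring

theorem monomialSubalgebra_arfExponents_five_le :
    monomialSubalgebra k (arfExponents 5) ≤ generatorArfClosure k 5 := by
  obtain ⟨hX, hXY, hY⟩ := generators_mem_generatorArfClosure k 5
  have hn : 5 ≠ 0 := by decide
  have h₉₆ : X 0 ^ 9 * X 1 ^ 6 ∈ generatorArfClosure k 5 := by
    have hu : X 0 ^ 4 * X 1 * (X 0 * X 1 ^ 4) ∈ generatorArfClosure k 5 := by
      convert mul_mem hX hY using 1
      ring
    convert mul_mul_mem_generatorArfClosure hn (by simp [X_ne_zero]) hXY hu hu using 1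
    ring
  have h₄₁₁ : X 0 ^ 4 * X 1 ^ 11 ∈ generatorArfClosure k 5 := by
    have hu : X 0 ^ 2 * X 1 ^ 3 * X 1 ^ 5 ∈ generatorArfClosure k 5 := by
      convert pow_mem hXY 2 using 1
      ring
    convert mul_mul_mem_generatorArfClosure hn (by simp [X_ne_zero]) hY hu hu using 1
    ring
  rw [arfExponents_five, monomialSubalgebra_closure_le_iff]
  simpa [monomial_bidegree] using
    ⟨hX, hXY, hY, h₉₆, X_pow_eight_mul_X_pow_seven_mem_generatorArfClosure h₉₆ h₄₁₁, h₄₁₁⟩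

variable {n : ℕ}

theorem bidegree_sub_one_add_one_notMem_arfExponents (hn : 4 ≤ n) :
    bidegree (n - 1) (n + 1) ∉ arfExponents n := by
  simp only [mem_arfExponents, bidegree_apply_zero, bidegree_apply_one]
  omega

theorem add_bidegree_sub_one_add_one_mem_arfExponents (hn : n ≠ 0)
    {v : Fin 2 →₀ ℕ} (hv : v ∈ arfExponents n) (hv₀ : v ≠ 0) :
    v + bidegree (n - 1) (n + 1) ∈ arfExponents n := by
  obtain ⟨⟨c, hc⟩, -⟩ := hv
  rw [Ne, exponent_ext_iff, Finsupp.zero_apply, Finsupp.zero_apply] at hv₀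
  simp only [mem_arfExponents, Finsupp.add_apply, bidegree_apply_zero, bidegree_apply_one]
  exact ⟨⟨c + 2, by rw [mul_add]; omega⟩, by omega, by omega⟩

variable (k) in
theorem not_serreCondition_two_arfExponents (hn : 4 ≤ n) :
    ¬ SerreCondition 2 (monomialSubalgebra k (arfExponents n)) := by
  have hn₀ : n ≠ 0 := by omega
  refine not_serreCondition_two_monomialSubalgebra k (j := 1) (s := bidegree n 0)
    (t := bidegree 0 n) ?_ ?_ ?_ ?_ ?_ (bidegree_sub_one_add_one_notMem_arfExponents hn) fun v =>
      add_bidegree_sub_one_add_one_mem_arfExponents hn₀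
  · simp [mem_arfExponents]
  · simpa using hn₀
  · simp [mem_arfExponents, hn₀]
  · simpa [exponent_ext_iff] using hn₀
  · simp

theorem bot_lt_weaklyArfClosure_generatorSubalgebra (hn : 4 ≤ n)
    (h : monomialSubalgebra k (arfExponents n) ≤ generatorArfClosure k n) :
    ⊥ < weaklyArfClosure (generatorSubalgebra k n) := by
  refine bot_lt_iff_ne_bot.2 fun hbot => ?_
  have hw : bidegree (2 * n - 1) (n + 1) ∈ arfExponents n := by
    simp only [mem_arfExponents, bidegree_apply_zero, bidegree_apply_one]
    exact ⟨⟨3, by omega⟩, by omega, by omega⟩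
  have hwC := h (monomial_mem_monomialSubalgebra.2 hw)
  rw [mem_generatorArfClosure, hbot, contraction_bot, Algebra.mem_bot] at hwC
  obtain ⟨r, hr⟩ := hwC
  have hwG : bidegree (2 * n - 1) (n + 1) ∈ generatorMonoid n := by
    rw [← monomial_mem_monomialSubalgebra (k := k), ← hr]
    exact r.2
  have := apply_one_of_mem_generatorMonoid hwG
  rw [bidegree_apply_one] at this
  omega

variable [IsIntegrallyClosed (MvPolynomial (Fin 2) k)]

theorem weaklyArfClosure_generatorSubalgebra_eq_strictClosure (hn : n ≠ 0)
    (h : monomialSubalgebra k (arfExponents n) ≤ generatorArfClosure k n) :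
    weaklyArfClosure (generatorSubalgebra k n) = strictClosure (generatorSubalgebra k n) :=
  weaklyArfClosure_eq_strictClosure_of_contraction_le (P := MvPolynomial (Fin 2) k) fun _ hf =>
    h (mem_of_mem_contraction_strictClosure hn hf)

theorem generatorArfClosure_le (hn : n ≠ 0) :
    generatorArfClosure k n ≤ monomialSubalgebra k (arfExponents n) :=
  fun _ hf => mem_of_mem_contraction_strictClosure hn
    (contraction_mono (weaklyArfClosure_le_strictClosure _) hf)

end PlaneClosure

theorem mainTheorem6_general (k : Type*) [CommRing k] [IsDomain k] [IsNoetherianRing k]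
    [IsIntegrallyClosed k] (R : Subalgebra k (MvPolynomial (Fin 2) k))
    (hR : R = Algebra.adjoin k {MvPolynomial.X 0 ^ 4, MvPolynomial.X 0 * MvPolynomial.X 1 ^ 3,
        MvPolynomial.X 1 ^ 4} ∨
      R = Algebra.adjoin k {MvPolynomial.X 0 ^ 5, MvPolynomial.X 0 * MvPolynomial.X 1 ^ 4,
        MvPolynomial.X 1 ^ 5}) :
    (⊥ : Subalgebra R (FractionRing R)) < weaklyArfClosure R ∧
      weaklyArfClosure R = strictClosure R ∧
      IsNoetherianRing (weaklyArfClosure R) ∧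
      ¬ SerreCondition 2 (weaklyArfClosure R) := by
  have := isIntegrallyClosed_mvPolynomial (Fin 2) k
  obtain ⟨n, hn, rfl, hfg, hle⟩ : ∃ n, 4 ≤ n ∧ R = generatorSubalgebra k n ∧
      (arfExponents n).FG ∧ monomialSubalgebra k (arfExponents n) ≤ generatorArfClosure k n := by
    obtain rfl | rfl := hR
    · exact ⟨4, le_rfl, adjoin_eq_generatorSubalgebra 4, fg_arfExponents_four,
        monomialSubalgebra_arfExponents_four_le⟩
    · exact ⟨5, by omega, adjoin_eq_generatorSubalgebra 5, fg_arfExponents_five,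
        monomialSubalgebra_arfExponents_five_le⟩
  have hn₀ : n ≠ 0 := by omega
  let e : weaklyArfClosure (generatorSubalgebra k n) ≃+* generatorArfClosure k n :=
    weaklyArfClosureEquiv (generatorSubalgebra k n) (MvPolynomial (Fin 2) k)
  have closure_eq := (generatorArfClosure_le hn₀).antisymm hle
  refine ⟨bot_lt_weaklyArfClosure_generatorSubalgebra hn hle,
    weaklyArfClosure_generatorSubalgebra_eq_strictClosure hn₀ hle, ?_, fun hS => ?_⟩
  · have := isNoetherianRing_monomialSubalgebra k hfg
    rw [← closure_eq] at this
    exact isNoetherianRing_of_ringEquiv _ e.symm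
  · have := hS.of_ringEquiv e
    rw [closure_eq] at this
    exact not_serreCondition_two_arfExponents k hn this

theorem mainTheorem6 (k : Type*) [Field k] (R : Subalgebra k (MvPolynomial (Fin 2) k))
    (hR : R = Algebra.adjoin k {MvPolynomial.X 0 ^ 4, MvPolynomial.X 0 * MvPolynomial.X 1 ^ 3,
        MvPolynomial.X 1 ^ 4} ∨
      R = Algebra.adjoin k {MvPolynomial.X 0 ^ 5, MvPolynomial.X 0 * MvPolynomial.X 1 ^ 4,
        MvPolynomial.X 1 ^ 5}) :
    (⊥ : Subalgebra R (FractionRing R)) < weaklyArfClosure R ∧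
      weaklyArfClosure R = strictClosure R ∧
      IsNoetherianRing (weaklyArfClosure R) ∧
      ¬ SerreCondition 2 (weaklyArfClosure R) :=
  mainTheorem6_general k R hR
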